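/- Let $r\ge 2$ be an integer and let $\lambda>0$ satisfy $\lambda<(r-1)^{r-1}/(r-2)^r$ (for $r=2$ the right-hand side is read as $+\infty$, so every $\lambda>0$ is allowed). For a finite simple graph $G$ let $\mathcal I(G)$ be the set of its independent sets and $Z(\lambda,G)=\sum_{I\in\mathcal I(G)}\lambda^{|I|}$. For $n\ge 1$ let $\mathcal G(n,g,r)$ be the set of all $r$-regular simple graphs with $n$ nodes and girth (length of a shortest cycle) at least $g$. Then the equation $x=1/(1+\lambda x^{r-1})$ has a unique positive solution $x$, and $$\lim_{g\to\infty}\ \sup_{n\ge 1,\ G\in\mathcal G(n,g,r)}\left|\frac{\log Z(\lambda,G)}{n}-\log\left(x^{-\frac r2}(2-x)^{-\frac{r-2}2}\right)\right|=0 .$$ When $\lambda=1$ and $r=2,3,4,5$, the corresponding limits for $n^{-1}\log|\mathcal I(G)|$, which are again uniform over all $r$-regular $n$-node graphs $G$ of girth at least $g$ as $g\to\infty$, are respectively $\log 1.618\ldots$, $\log 1.545\ldots$, $\log 1.4936\ldots$ and $\log 1.453\ldots$, each being $\log\left(x^{-\frac r2}(2-x)^{-\frac{r-2}2}\right)$ for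 the positive solution $x$ of $x=1/(1+x^{r-1})$. -/

import Mathlib

open Filter Topology
open scoped ENNReal

noncomputable section

namespace HardCore

open Classical in
/-- The finite set of all independent sets of a finite simple graph. -/
def indepSets {V : Type*} [Fintype V] (G : SimpleGraph V) : Finset (Finset V) :=
  Finset.univ.filter fun I => G.IsIndepSet (I : Set V)

/-- The hard-core partition function `Z(l, G)`: the sum of `l ^ |I|` over all independent
sets `I` of `G`. -/
def partitionFunction {V : Type*} [Fintype V] (l : ℝ) (G : SimpleGraph V) : ℝ :=
  ∑ I ∈ indepSets G, l ^ I.card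

open Classical in
/-- The `r`-regular simple graphs on `n` labelled nodes with girth at least `g`
(a graph without cycles has infinite girth). -/
def regularGraphs (n g r : ℕ) : Set (SimpleGraph (Fin n)) :=
  {G | G.IsRegularOfDegree r ∧ (g : ℕ∞) ≤ G.egirth}

/-- The supremum of `|log (F G) / n - c|` over all `n ≥ 1` and all `r`-regular `n`-node graphs
`G` of girth at least `g`, as an extended nonnegative real number. -/
def supDeviation (r g : ℕ) (F : ∀ {n : ℕ}, SimpleGraph (Fin n) → ℝ) (c : ℝ) : ℝ≥0∞ :=
  ⨆ (n : ℕ) (_ : 1 ≤ n) (G : SimpleGraph (Fin n)) (_ : G ∈ regularGraphs n g r),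
    ENNReal.ofReal |Real.log (F G) / n - c|

/-- `x` is a positive solution of `x = 1 / (1 + l * x ^ (r - 1))`. -/
def IsPositiveSolution (r : ℕ) (l x : ℝ) : Prop :=
  0 < x ∧ x = 1 / (1 + l * x ^ (r - 1))

/-- The number `x ^ (-r / 2) * (2 - x) ^ (-(r - 2) / 2)`, with real exponents. -/
def growthRate (r : ℕ) (x : ℝ) : ℝ :=
  x ^ (-((r : ℝ) / 2)) * (2 - x) ^ (-(((r : ℝ) - 2) / 2))

end HardCore

end

/-! Write r = d + 1. The argument is the cavity method. If v has lost one neighbour and its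
surroundings are otherwise an intact tree, the ratio Z(S - v)/Z(S) equals 1/(1 + l ∏ of d similar
ratios at its children). Starting from the trivial bounds 0 and 1, k rounds of this decreasing map
enclose every such ratio, provided the girth is at least k + 2 (`bounds_inducedSum`). Below the
critical activity the map has no two-cycle (`not_two_cycle_of_lt`), so both bounds tend to its fixed
point x.

The derivative of log Z in l is the sum over v of Z(G - N[v])/Z(G), and each term is close to
x^(d+1)/(2 - x) (`bounds_root`, `abs_sub_le_gap`). It is then integrated along the curve l = (1 -
x)/x^(d+1), from x = 1, where l = 0 and log Z = 0, down to the given solution. The claimed limit has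
exactly the matching derivative. Dini's theorem makes the error uniform along the curve
(`tendstoUniformlyOn_gap`), and the mean value inequality gives a bound independent of n and G. -/

namespace HardCore

/-! ### Deletion identities and the local tree structure forced by girth -/

section Recursion

variable {V : Type*} {G : SimpleGraph V}

open Classical in
/-- The sum of `w |I|` over all independent sets `I` of `G` contained in `S`. -/
noncomputable def weightSum (G : SimpleGraph V) (w : ℕ → ℝ) (S : Finset V) : ℝ :=
  ∑ I ∈ S.powerset.filter fun I : Finset V => G.IsIndepSet (I : Set V), w I.card

/-- The hard-core partition function of the subgraph of `G` induced by `S`. -/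
noncomputable def inducedSum (G : SimpleGraph V) (l : ℝ) (S : Finset V) : ℝ :=
  weightSum G (fun k => l ^ k) S

theorem partitionFunction_eq_inducedSum [Fintype V] (l : ℝ) (G : SimpleGraph V) :
    partitionFunction l G = inducedSum G l Finset.univ := by
  classical
  unfold partitionFunction inducedSum weightSum indepSets
  refine Finset.sum_congr ?_ fun _ _ => rfl
  ext I
  simp

theorem one_le_inducedSum {l : ℝ} (hl : 0 ≤ l) (S : Finset V) : 1 ≤ inducedSum G l S := by
  classical
  unfold inducedSum weightSum
  have h : (∅ : Finset V) ∈ S.powerset.filter fun I : Finset V => G.IsIndepSet (I : Set V) := by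
    simp [SimpleGraph.IsIndepSet]
  simpa using Finset.single_le_sum (f := fun I : Finset V => l ^ I.card)
    (fun I _ => pow_nonneg hl _) h

theorem inducedSum_pos {l : ℝ} (hl : 0 ≤ l) (S : Finset V) : 0 < inducedSum G l S :=
  zero_lt_one.trans_le (one_le_inducedSum hl S)

theorem partitionFunction_zero [Fintype V] (G : SimpleGraph V) : partitionFunction 0 G = 1 := by
  classical
  unfold partitionFunction indepSets
  rw [Finset.sum_eq_single (∅ : Finset V)]
  · simp
  · intro I _ hI
    exact zero_pow (by simpa using hI)
  · intro h
    simp [SimpleGraph.IsIndepSet] at h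

theorem partitionFunction_one [Fintype V] (G : SimpleGraph V) :
    partitionFunction 1 G = ((indepSets G).card : ℝ) := by
  simp [partitionFunction]

/-- All paths of length at most `k` that start at `v` and avoid the neighbour `u ∉ S` of `v`
stay in `S`. -/
def IsLocallyFull (G : SimpleGraph V) (k : ℕ) (S : Finset V) (v u : V) : Prop :=
  u ∉ S ∧ G.Adj v u ∧
    ∀ (w : V) (p : G.Walk v w), p.IsPath → p.length ≤ k → u ∉ p.support → w ∈ S

theorem IsLocallyFull.mem {k : ℕ} {S : Finset V} {v u : V} (h : IsLocallyFull G k S v u) :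
    v ∈ S :=
  h.2.2 v SimpleGraph.Walk.nil (by simp) (by simp) (by simpa using h.2.1.ne')

/-- Joining both ends of the path to v closes a cycle. Girth enters the argument only through this.
-/
theorem egirth_le_of_isPath {v w y : V} (p : G.Walk w y) (hp : p.IsPath) (hv : v ∉ p.support)
    (hw : G.Adj v w) (hy : G.Adj v y) (hne : y ≠ w) : G.egirth ≤ (p.length + 2 : ℕ) := by
  have hc : (SimpleGraph.Walk.cons hy.symm (SimpleGraph.Walk.cons hw p)).IsCycle := by
    rw [SimpleGraph.Walk.cons_isCycle_iff]
    refine ⟨hp.cons hv, ?_⟩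
    rw [SimpleGraph.Walk.edges_cons, List.mem_cons, not_or]
    refine ⟨?_, fun h => hv (p.snd_mem_support_of_mem_edges h)⟩
    intro h
    rw [Sym2.eq_iff] at h
    rcases h with ⟨h, _⟩ | ⟨h, _⟩
    · exact hy.ne h.symm
    · exact hne h
  have h := SimpleGraph.egirth_le_length hc
  rwa [SimpleGraph.Walk.length_cons, SimpleGraph.Walk.length_cons] at h

variable [DecidableEq V]

-- Remove v from each set. The weight is arbitrary so that l^k yields the deletion recurrence and
-- l^(k-1) the derivative of Z.
open Classical in
theorem sum_indepSets_mem [G.LocallyFinite] (w : ℕ → ℝ) {S : Finset V} {v : V} (hv : v ∈ S) :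
    (∑ I ∈ S.powerset.filter fun I : Finset V => G.IsIndepSet (I : Set V) ∧ v ∈ I, w I.card) =
      weightSum G (fun k => w (k + 1)) (S.erase v \ G.neighborFinset v) := by
  unfold weightSum
  symm
  refine Finset.sum_bij' (fun J _ => insert v J) (fun I _ => I.erase v) ?_ ?_ ?_ ?_ ?_
  · intro J hJ
    simp only [Finset.mem_filter, Finset.mem_powerset] at hJ ⊢
    refine ⟨?_, ?_, Finset.mem_insert_self _ _⟩
    · refine Finset.insert_subset hv fun x hx => ?_
      have := hJ.1 hx
      simp only [Finset.mem_sdiff, Finset.mem_erase] at this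
      exact this.1.2
    · rw [Finset.coe_insert, SimpleGraph.IsIndepSet, Set.pairwise_insert]
      refine ⟨hJ.2, fun b hb _ => ?_⟩
      have := hJ.1 hb
      simp only [Finset.mem_sdiff, SimpleGraph.mem_neighborFinset] at this
      exact ⟨this.2, fun h => this.2 h.symm⟩
  · intro I hI
    simp only [Finset.mem_filter, Finset.mem_powerset] at hI ⊢
    refine ⟨fun x hx => ?_, ?_⟩
    · rw [Finset.mem_erase] at hx
      simp only [Finset.mem_sdiff, Finset.mem_erase, SimpleGraph.mem_neighborFinset]
      exact ⟨⟨hx.1, hI.1 hx.2⟩, hI.2.1 hI.2.2 hx.2 hx.1.symm⟩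
    · exact hI.2.1.mono (by simp)
  · intro J hJ
    simp only [Finset.mem_filter, Finset.mem_powerset] at hJ
    refine Finset.erase_insert fun h => ?_
    simpa using hJ.1 h
  · intro I hI
    simp only [Finset.mem_filter] at hI
    exact Finset.insert_erase hI.2.2
  · intro J hJ
    simp only [Finset.mem_filter, Finset.mem_powerset] at hJ
    rw [Finset.card_insert_of_notMem fun h => ?_]
    simpa using hJ.1 h

theorem inducedSum_eq_erase_add [G.LocallyFinite] (l : ℝ) {S : Finset V} {v : V} (hv : v ∈ S) :
    inducedSum G l S =
      inducedSum G l (S.erase v) + l * inducedSum G l (S.erase v \ G.neighborFinset v) := by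
  classical
  have h1 := sum_indepSets_mem (G := G) (fun k => l ^ k) hv
  have h2 : weightSum G (fun k => l ^ (k + 1)) (S.erase v \ G.neighborFinset v) =
      l * inducedSum G l (S.erase v \ G.neighborFinset v) := by
    simp only [inducedSum, weightSum, Finset.mul_sum, pow_succ']
  rw [← h2, ← h1]
  unfold inducedSum weightSum
  rw [← Finset.sum_filter_add_sum_filter_not _ (fun I => v ∉ I)]
  congr 1
  · refine Finset.sum_congr ?_ fun _ _ => rfl
    ext I
    simp only [Finset.mem_filter, Finset.mem_powerset, Finset.subset_erase]
    tauto
  · refine Finset.sum_congr ?_ fun _ _ => rfl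
    ext I
    simp only [Finset.mem_filter, Finset.mem_powerset, not_not]
    tauto

/-- Double counting of pairs v ∈ I: the factor |I| from differentiating l^|I| counts the choices of
v. -/
theorem hasDerivAt_partitionFunction [G.LocallyFinite] [Fintype V] (l : ℝ) :
    HasDerivAt (fun t => partitionFunction t G)
      (∑ v, inducedSum G l (Finset.univ.erase v \ G.neighborFinset v)) l := by
  classical
  have h : HasDerivAt (fun t => partitionFunction t G)
      (∑ I ∈ indepSets G, (I.card : ℝ) * l ^ (I.card - 1)) l := by
    unfold partitionFunction
    exact HasDerivAt.fun_sum fun I _ => hasDerivAt_pow _ _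
  convert h using 1
  have h1 : ∀ v : V, inducedSum G l (Finset.univ.erase v \ G.neighborFinset v) =
      ∑ I ∈ indepSets G, if v ∈ I then l ^ (I.card - 1) else 0 := by
    intro v
    have := sum_indepSets_mem (G := G) (fun k => l ^ (k - 1)) (Finset.mem_univ v)
    simp only [Nat.add_sub_cancel] at this
    rw [inducedSum, ← this, ← Finset.sum_filter]
    refine Finset.sum_congr ?_ fun _ _ => rfl
    ext I
    simp [indepSets]
  simp_rw [h1]
  rw [Finset.sum_comm]
  refine Finset.sum_congr rfl fun I _ => ?_
  rw [← Finset.sum_filter]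
  simp

/-- Telescoping: the vertices of T are deleted one at a time, each deletion costing a factor at
least a. -/
theorem pow_card_mul_inducedSum_le {l a : ℝ} (ha : 0 ≤ a) (S T : Finset V)
    (h : ∀ T' ⊆ T, ∀ w ∈ T, w ∉ T' →
      a * inducedSum G l (S \ T') ≤ inducedSum G l ((S \ T').erase w)) :
    a ^ T.card * inducedSum G l S ≤ inducedSum G l (S \ T) := by
  induction T using Finset.induction_on with
  | empty => simp
  | insert w T hw ih =>
    have h1 := ih fun T' hT' x hx hxT' =>
      h T' (hT'.trans (Finset.subset_insert _ _)) x (Finset.mem_insert_of_mem hx) hxT'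
    have h2 := h T (Finset.subset_insert _ _) w (Finset.mem_insert_self _ _) hw
    rw [Finset.card_insert_of_notMem hw, Finset.sdiff_insert, pow_succ', mul_assoc]
    exact (mul_le_mul_of_nonneg_left h1 ha).trans h2

theorem inducedSum_le_pow_card_mul {l b : ℝ} (hb : 0 ≤ b) (S T : Finset V)
    (h : ∀ T' ⊆ T, ∀ w ∈ T, w ∉ T' →
      inducedSum G l ((S \ T').erase w) ≤ b * inducedSum G l (S \ T')) :
    inducedSum G l (S \ T) ≤ b ^ T.card * inducedSum G l S := by
  induction T using Finset.induction_on with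
  | empty => simp
  | insert w T hw ih =>
    have h1 := ih fun T' hT' x hx hxT' =>
      h T' (hT'.trans (Finset.subset_insert _ _)) x (Finset.mem_insert_of_mem hx) hxT'
    have h2 := h T (Finset.subset_insert _ _) w (Finset.mem_insert_self _ _) hw
    rw [Finset.card_insert_of_notMem hw, Finset.sdiff_insert, pow_succ', mul_assoc]
    exact h2.trans (mul_le_mul_of_nonneg_left h1 hb)

theorem isLocallyFull_univ [G.LocallyFinite] [Fintype V] {k : ℕ} (hg : ((k + 3 : ℕ) : ℕ∞) ≤ G.egirth) {v w : V}
    {T : Finset V} (hT : T ⊆ G.neighborFinset v) (hw : G.Adj v w) (hwT : w ∉ T) :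
    IsLocallyFull G k (Finset.univ.erase v \ T) w v := by
  refine ⟨by simp, hw.symm, fun x p hp hk hv => ?_⟩
  have hx : x ≠ v := fun h => hv (h ▸ p.end_mem_support)
  simp only [Finset.mem_sdiff, Finset.mem_erase, Finset.mem_univ, and_true]
  refine ⟨hx, fun hxT => ?_⟩
  have h1 := egirth_le_of_isPath p hp hv hw (by simpa using hT hxT) fun h => hwT (h ▸ hxT)
  have h2 := Nat.cast_le.1 (hg.trans h1)
  omega

/-- Passing to a child w of v uses up one unit of depth. A path of length at most k from w to
another neighbour of v would close a cycle of length at most k + 2. -/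
theorem IsLocallyFull.step [G.LocallyFinite] {k : ℕ} (hg : ((k + 3 : ℕ) : ℕ∞) ≤ G.egirth) {S : Finset V}
    {v u w : V} (h : IsLocallyFull G (k + 1) S v u) {T : Finset V}
    (hT : T ⊆ G.neighborFinset v) (hw : G.Adj v w) (hwu : w ≠ u) (hwT : w ∉ T) :
    IsLocallyFull G k (S.erase v \ T) w v := by
  refine ⟨by simp, hw.symm, fun x p hp hk hv => ?_⟩
  have hx : x ≠ v := fun h => hv (h ▸ p.end_mem_support)
  -- The parent u is also a neighbour of v, so reaching it without v would already close a short
  -- cycle.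
  have hu : u ∉ p.support := by
    intro hu
    have h1 := egirth_le_of_isPath (p.takeUntil u hu) (hp.takeUntil hu)
      (fun h' => hv (p.support_takeUntil_subset_support hu h')) hw h.2.1 hwu.symm
    have h2 := Nat.cast_le.1 (hg.trans h1)
    have h3 := p.length_takeUntil_le_length hu
    omega
  simp only [Finset.mem_sdiff, Finset.mem_erase]
  refine ⟨⟨hx, ?_⟩, fun hxT => ?_⟩
  · refine h.2.2 x (SimpleGraph.Walk.cons hw p) (hp.cons hv) (by simpa using hk) ?_
    simp only [SimpleGraph.Walk.support_cons, List.mem_cons, not_or]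
    exact ⟨h.2.1.ne', hu⟩
  · have h1 := egirth_le_of_isPath p hp hv hw (by simpa using hT hxT) fun h => hwT (h ▸ hxT)
    have h2 := Nat.cast_le.1 (hg.trans h1)
    omega

end Recursion

/-! ### Two-sided bounds on cavity ratios -/

section Bounds

/-- The map `y ↦ 1 / (1 + l * y ^ d)` of the tree recursion. -/
noncomputable def treeMap (d : ℕ) (l y : ℝ) : ℝ := 1 / (1 + l * y ^ d)

/-- The lower and upper bounds obtained from `0` and `1` by iterating `treeMap`. -/
noncomputable def bounds (d : ℕ) (l : ℝ) : ℕ → ℝ × ℝ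
  | 0 => (0, 1)
  | k + 1 => (treeMap d l (bounds d l k).2, treeMap d l (bounds d l k).1)

variable {d : ℕ} {l : ℝ}

theorem treeMap_pos (hl : 0 ≤ l) {y : ℝ} (hy : 0 ≤ y) : 0 < treeMap d l y := by
  unfold treeMap; positivity

theorem treeMap_le_one (hl : 0 ≤ l) {y : ℝ} (hy : 0 ≤ y) : treeMap d l y ≤ 1 := by
  unfold treeMap
  rw [div_le_one (by positivity)]
  have : 0 ≤ l * y ^ d := by positivity
  linarith

theorem treeMap_anti (hl : 0 ≤ l) {y z : ℝ} (hy : 0 ≤ y) (hyz : y ≤ z) :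
    treeMap d l z ≤ treeMap d l y := by
  unfold treeMap; gcongr

theorem bounds_fst_nonneg (hl : 0 ≤ l) (k : ℕ) :
    0 ≤ (bounds d l k).1 ∧ (bounds d l k).1 ≤ (bounds d l k).2 ∧ (bounds d l k).2 ≤ 1 := by
  induction k with
  | zero => simp [bounds]
  | succ k ih =>
    exact ⟨(treeMap_pos hl (ih.1.trans ih.2.1)).le, treeMap_anti hl ih.1 ih.2.1,
      treeMap_le_one hl ih.1⟩

theorem bounds_snd_nonneg (hl : 0 ≤ l) (k : ℕ) : 0 ≤ (bounds d l k).2 :=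
  (bounds_fst_nonneg hl k).1.trans (bounds_fst_nonneg hl k).2.1

theorem bounds_step (hl : 0 ≤ l) (k : ℕ) :
    (bounds d l k).1 ≤ (bounds d l (k + 1)).1 ∧ (bounds d l (k + 1)).2 ≤ (bounds d l k).2 := by
  induction k with
  | zero => exact ⟨(bounds_fst_nonneg hl 1).1, (bounds_fst_nonneg hl 1).2.2⟩
  | succ k ih =>
    exact ⟨treeMap_anti hl (bounds_snd_nonneg hl _) ih.2,
      treeMap_anti hl (bounds_fst_nonneg hl _).1 ih.1⟩

theorem bounds_mem_of_fixed (hl : 0 ≤ l) {x : ℝ} (hx0 : 0 ≤ x) (hx : treeMap d l x = x) (k : ℕ) :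
    (bounds d l k).1 ≤ x ∧ x ≤ (bounds d l k).2 := by
  induction k with
  | zero => exact ⟨hx0, hx ▸ treeMap_le_one hl hx0⟩
  | succ k ih =>
    constructor
    · calc _ ≤ treeMap d l x := treeMap_anti hl hx0 ih.2
        _ = x := hx
    · calc x = treeMap d l x := hx.symm
        _ ≤ _ := treeMap_anti hl (bounds_fst_nonneg hl k).1 ih.1

variable {V : Type*} [DecidableEq V] {G : SimpleGraph V} [G.LocallyFinite]

theorem bounds_inducedSum (hl : 0 ≤ l) (hd : G.IsRegularOfDegree (d + 1)) (k : ℕ)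
    (hg : ((k + 2 : ℕ) : ℕ∞) ≤ G.egirth) {S : Finset V} {v u : V}
    (h : IsLocallyFull G k S v u) :
    (bounds d l k).1 * inducedSum G l S ≤ inducedSum G l (S.erase v) ∧
      inducedSum G l (S.erase v) ≤ (bounds d l k).2 * inducedSum G l S := by
  induction k generalizing S v u with
  | zero =>
    simp only [bounds, zero_mul, one_mul]
    refine ⟨(inducedSum_pos hl _).le, ?_⟩
    rw [inducedSum_eq_erase_add l h.mem]
    have := mul_nonneg hl (inducedSum_pos (G := G) hl (S.erase v \ G.neighborFinset v)).le
    linarith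
  | succ k ih =>
    have hg' : ((k + 2 : ℕ) : ℕ∞) ≤ G.egirth := le_trans (by norm_cast; omega) hg
    -- The parent u is already outside S, so only the other d neighbours contribute factors.
    have hN : S.erase v \ G.neighborFinset v = S.erase v \ (G.neighborFinset v).erase u := by
      ext x
      simp only [Finset.mem_sdiff, Finset.mem_erase]
      refine ⟨fun hx => ⟨hx.1, fun h' => hx.2 h'.2⟩, fun hx => ⟨hx.1, fun h' => hx.2 ⟨?_, h'⟩⟩⟩
      rintro rfl
      exact h.1 hx.1.2
    have hcard : ((G.neighborFinset v).erase u).card = d := by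
      rw [Finset.card_erase_of_mem (by simpa using h.2.1), SimpleGraph.card_neighborFinset_eq_degree,
        hd v, Nat.add_sub_cancel]
    have key : ∀ T' ⊆ (G.neighborFinset v).erase u, ∀ w ∈ (G.neighborFinset v).erase u,
        w ∉ T' → IsLocallyFull G k (S.erase v \ T') w v := by
      intro T' hT' w hw hwT'
      rw [Finset.mem_erase, SimpleGraph.mem_neighborFinset] at hw
      exact h.step hg (hT'.trans (Finset.erase_subset _ _)) hw.2 hw.1 hwT'
    have hlow := pow_card_mul_inducedSum_le (bounds_fst_nonneg hl k).1 (S.erase v)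
      ((G.neighborFinset v).erase u)
      fun T' hT' w hw hwT' => (ih hg' (key T' hT' w hw hwT')).1
    have hup := inducedSum_le_pow_card_mul (bounds_snd_nonneg hl k) (S.erase v)
      ((G.neighborFinset v).erase u)
      fun T' hT' w hw hwT' => (ih hg' (key T' hT' w hw hwT')).2
    rw [← hN, hcard] at hlow hup
    have hrec := inducedSum_eq_erase_add (G := G) l h.mem
    have ha := (bounds_fst_nonneg (d := d) hl k).1
    have hb := bounds_snd_nonneg (d := d) hl k
    simp only [bounds, treeMap]
    constructor
    -- The tree map is decreasing: the lower bound at v comes from the upper bounds at its children.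
    · rw [div_mul_eq_mul_div, one_mul, div_le_iff₀ (by positivity), hrec]
      nlinarith [mul_le_mul_of_nonneg_left hup hl]
    · rw [div_mul_eq_mul_div, one_mul, le_div_iff₀ (by positivity), hrec]
      nlinarith [mul_le_mul_of_nonneg_left hlow hl]

/-- At the root all d + 1 neighbours are present. With y = Z(G - N[v])/Z(G - v), a product of d + 1
cavity ratios, the deletion recurrence gives Z(G - N[v])/Z(G) = y/(1 + l y). -/
theorem bounds_root [Fintype V] (hl : 0 ≤ l) (hd : G.IsRegularOfDegree (d + 1)) (k : ℕ)
    (hg : ((k + 3 : ℕ) : ℕ∞) ≤ G.egirth) (v : V) :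
    (bounds d l k).1 ^ (d + 1) / (1 + l * (bounds d l k).1 ^ (d + 1)) * partitionFunction l G ≤
        inducedSum G l (Finset.univ.erase v \ G.neighborFinset v) ∧
      inducedSum G l (Finset.univ.erase v \ G.neighborFinset v) ≤
        (bounds d l k).2 ^ (d + 1) / (1 + l * (bounds d l k).2 ^ (d + 1)) *
          partitionFunction l G := by
  have hg' : ((k + 2 : ℕ) : ℕ∞) ≤ G.egirth := le_trans (by norm_cast; omega) hg
  have hcard : (G.neighborFinset v).card = d + 1 := by
    rw [SimpleGraph.card_neighborFinset_eq_degree, hd v]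
  have key : ∀ T' ⊆ G.neighborFinset v, ∀ w ∈ G.neighborFinset v,
      w ∉ T' → IsLocallyFull G k (Finset.univ.erase v \ T') w v := by
    intro T' hT' w hw hwT'
    exact isLocallyFull_univ hg hT' (by simpa using hw) hwT'
  have hlow := pow_card_mul_inducedSum_le (bounds_fst_nonneg hl k).1 (Finset.univ.erase v)
    (G.neighborFinset v)
    fun T' hT' w hw hwT' => (bounds_inducedSum hl hd k hg' (key T' hT' w hw hwT')).1
  have hup := inducedSum_le_pow_card_mul (bounds_snd_nonneg hl k) (Finset.univ.erase v)
    (G.neighborFinset v)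
    fun T' hT' w hw hwT' => (bounds_inducedSum hl hd k hg' (key T' hT' w hw hwT')).2
  rw [hcard] at hlow hup
  have hrec := inducedSum_eq_erase_add (G := G) l (Finset.mem_univ v)
  have ha := (bounds_fst_nonneg (d := d) hl k).1
  have hb := bounds_snd_nonneg (d := d) hl k
  rw [partitionFunction_eq_inducedSum, hrec]
  constructor
  · rw [div_mul_eq_mul_div, div_le_iff₀ (by positivity)]
    nlinarith
  · rw [div_mul_eq_mul_div, le_div_iff₀ (by positivity)]
    nlinarith

end Bounds

/-! ### Absence of two-cycles below the critical activity -/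

section TwoCycle

-- AM-GM for the powers of u², whose geometric mean is u^m; the induction step is Bernoulli's
-- inequality.
open Finset in
theorem mul_pow_le_geom_sum_sq {u : ℝ} (hu : 0 < u) (m : ℕ) :
    ((m : ℝ) + 1) * u ^ m ≤ ∑ i ∈ range (m + 1), (u ^ 2) ^ i := by
  induction m with
  | zero => simp
  | succ m ih =>
    rw [sum_range_succ]
    have hb := one_add_mul_le_pow (a := u - 1) (by linarith) (m + 2)
    push_cast at hb ⊢
    have h : u ^ m * (1 + (m + 2) * (u - 1)) ≤ u ^ m * u ^ (m + 2) := by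
      refine mul_le_mul_of_nonneg_left ?_ (by positivity)
      calc _ ≤ _ := hb
        _ = u ^ (m + 2) := by ring
    calc ((m : ℝ) + 1 + 1) * u ^ (m + 1) = (m + 1) * u ^ m + u ^ m * (1 + (m + 2) * (u - 1)) := by
          ring
      _ ≤ ∑ i ∈ range (m + 1), (u ^ 2) ^ i + u ^ m * u ^ (m + 2) := add_le_add ih h
      _ = _ := by ring

open Finset in
theorem geom_sum_mul_geom_sum (t : ℝ) (m : ℕ) :
    (∑ i ∈ range (m + 2), t ^ i) * ∑ i ∈ range m, t ^ i =
      (∑ i ∈ range (m + 1), t ^ i) ^ 2 - t ^ m := by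
  rw [sum_range_succ _ (m + 1), sum_range_succ _ m]
  have h : (∑ i ∈ range m, t ^ i) * (t - 1) = t ^ m - 1 := geom_sum_mul t m
  linear_combination t ^ m * h

-- Equality holds at t = 1. For d = m + 2 this says that the activity supporting a two-cycle of
-- ratio t is at least the critical one.
open Finset in
theorem mul_geom_sum_pow_le {t : ℝ} (ht : 0 < t) (m : ℕ) :
    t * ((m : ℝ) + 2) ^ (m + 2) * (∑ i ∈ range (m + 1), t ^ i) ^ (m + 3) ≤
      (∑ i ∈ range (m + 2), t ^ i) ^ (m + 2) * ((m : ℝ) + 1) ^ (m + 3) := by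
  induction m with
  | zero =>
    norm_num [sum_range_succ]
    nlinarith [sq_nonneg (t - 1)]
  | succ m ih =>
    set A := ∑ i ∈ range (m + 1), t ^ i with hA
    set B := ∑ i ∈ range (m + 2), t ^ i with hB
    set C := ∑ i ∈ range (m + 3), t ^ i with hC
    have hApos : 0 < A := by rw [hA, sum_range_succ']; positivity
    have hBpos : 0 < B := by rw [hB, sum_range_succ']; positivity
    have hCpos : 0 < C := by rw [hC, sum_range_succ']; positivity
    have hCA : C * A = B ^ 2 - t ^ (m + 1) := geom_sum_mul_geom_sum t (m + 1)
    have hsq : ((m : ℝ) + 2) ^ 2 * t ^ (m + 1) ≤ B ^ 2 := by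
      have h := mul_pow_le_geom_sum_sq (Real.sqrt_pos.2 ht) (m + 1)
      rw [Real.sq_sqrt ht.le] at h
      push_cast at h
      have h' := pow_le_pow_left₀ (by positivity) h 2
      rw [mul_pow, ← pow_mul, mul_comm (m + 1), pow_mul, Real.sq_sqrt ht.le] at h'
      calc _ = ((m : ℝ) + 1 + 1) ^ 2 * t ^ (m + 1) := by ring
        _ ≤ _ := h'
    -- Since (m + 1)(m + 3) = (m + 2)² - 1, this is AM-GM applied to the defect t^(m+1) of B² - CA.
    have hlc : ((m : ℝ) + 1) * (m + 3) * B ^ 2 ≤ (m + 2) ^ 2 * (C * A) := by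
      rw [hCA]; nlinarith
    push_cast
    have e1 : (m : ℝ) + 1 + 2 = m + 3 := by ring
    have e2 : (m : ℝ) + 1 + 1 = m + 2 := by ring
    rw [e1, e2]
    have hpos : 0 < ((m : ℝ) + 2) ^ (m + 2) * A ^ (m + 3) * (((m : ℝ) + 1) ^ (m + 3) * B ^ (m + 2)) := by
      positivity
    -- The induction hypothesis times the (m + 3)rd power of `hlc` is the goal up to this common
    -- factor.
    refine le_of_mul_le_mul_left ?_ hpos
    calc _ = (t * ((m : ℝ) + 2) ^ (m + 2) * A ^ (m + 3)) *
            ((((m : ℝ) + 1) * (m + 3) * B ^ 2) ^ (m + 3)) := by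
          simp only [mul_pow]; ring
      _ ≤ (B ^ (m + 2) * ((m : ℝ) + 1) ^ (m + 3)) * (((m + 2) ^ 2 * (C * A)) ^ (m + 3)) := by
          gcongr
      _ = _ := by
          generalize (m : ℝ) + 2 = q
          simp only [mul_pow]
          ring

open Finset in
theorem not_two_cycle_of_lt {d : ℕ} (hd : 1 ≤ d) {l A B : ℝ} (hl : 0 ≤ l)
    (hlc : 1 < d → l < (d : ℝ) ^ d / ((d : ℝ) - 1) ^ (d + 1)) (hA : 0 < A) (hAB : A < B)
    (h1 : treeMap d l B = A) (h2 : treeMap d l A = B) : False := by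
  have hB : 0 < B := hA.trans hAB
  unfold treeMap at h1 h2
  rw [div_eq_iff (by positivity)] at h1 h2
  obtain ⟨t, ht, rfl⟩ : ∃ t, 1 < t ∧ B = t * A :=
    ⟨B / A, (one_lt_div hA).2 hAB, (div_mul_cancel₀ B hA.ne').symm⟩
  have ht0 : 0 < t := by linarith
  obtain ⟨m, rfl⟩ | rfl : (∃ m, d = m + 2) ∨ d = 1 := by
    rcases Nat.lt_or_ge d 2 with h | h
    · right; omega
    · left; exact ⟨d - 2, by omega⟩
  · have hlc := hlc (by omega)
    set S := ∑ i ∈ range (m + 1), t ^ i with hS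
    set S' := ∑ i ∈ range (m + 2), t ^ i with hS'
    have hSpos : 0 < S := sum_pos (fun i _ => pow_pos ht0 i) ⟨0, by simp⟩
    have g1 : S * (t - 1) = t ^ (m + 1) - 1 := geom_sum_mul t (m + 1)
    have g2 : S' = S + t ^ (m + 1) := sum_range_succ _ _
    -- Subtract the two cycle equations and divide by A(t - 1). Together with `e2` this lets A be
    -- eliminated in `e3`, leaving l as a function of t.
    have e1 : l * A ^ (m + 2) * t * S = 1 := by
      have : A * (t - 1) * (l * A ^ (m + 2) * t * S - 1) = 0 := by
        have : A * (t - 1) * (l * A ^ (m + 2) * t * S - 1) =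
            l * A ^ (m + 3) * t * (S * (t - 1)) - A * (t - 1) := by ring
        rw [this, g1]
        linear_combination h2 - h1
      have hne : A * (t - 1) ≠ 0 := mul_ne_zero hA.ne' (by linarith)
      have := (mul_eq_zero.1 this).resolve_left hne
      linarith
    have e2 : A * S' = S := by
      have : 1 = A + A * (l * A ^ (m + 2) * t) * t ^ (m + 1) := by
        linear_combination h1
      rw [g2]
      linear_combination (-S) * this - A * t ^ (m + 1) * e1
    have e3 : l * t * S ^ (m + 3) = S' ^ (m + 2) := by
      have : (A * S') ^ (m + 2) = S ^ (m + 2) := by rw [e2]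
      rw [mul_pow] at this
      have hApow : A ^ (m + 2) ≠ 0 := by positivity
      refine mul_left_cancel₀ hApow ?_
      rw [this]
      linear_combination S ^ (m + 2) * e1
    have e4 := mul_geom_sum_pow_le ht0 m
    rw [← hS, ← hS', ← e3] at e4
    push_cast at hlc
    have e5 : (m : ℝ) + 2 - 1 = m + 1 := by ring
    rw [e5, lt_div_iff₀ (by positivity)] at hlc
    have e6 : t * S ^ (m + 3) * (l * ((m : ℝ) + 1) ^ (m + 3)) < t * S ^ (m + 3) * ((m : ℝ) + 2) ^ (m + 2) := by
      exact mul_lt_mul_of_pos_left hlc (mul_pos ht0 (pow_pos hSpos _))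
    nlinarith
  · have : A * (t - 1) = 0 := by linear_combination h1 - h2
    have := mul_pos hA (sub_pos.2 ht)
    linarith

theorem tendsto_bounds {d : ℕ} (hd : 1 ≤ d) {l : ℝ} (hl : 0 ≤ l)
    (hlc : 1 < d → l < (d : ℝ) ^ d / ((d : ℝ) - 1) ^ (d + 1)) :
    ∃ x, Tendsto (fun k => (bounds d l k).1) atTop (𝓝 x) ∧
      Tendsto (fun k => (bounds d l k).2) atTop (𝓝 x) := by
  have hm : Monotone fun k => (bounds d l k).1 :=
    monotone_nat_of_le_succ fun k => (bounds_step hl k).1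
  have ha : Antitone fun k => (bounds d l k).2 :=
    antitone_nat_of_succ_le fun k => (bounds_step hl k).2
  have hA := tendsto_atTop_ciSup hm ⟨1, by
    rintro _ ⟨k, rfl⟩
    exact (bounds_fst_nonneg hl k).2.1.trans (bounds_fst_nonneg hl k).2.2⟩
  have hB := tendsto_atTop_ciInf ha ⟨0, by
    rintro _ ⟨k, rfl⟩
    exact bounds_snd_nonneg hl k⟩
  set A := ⨆ k, (bounds d l k).1
  set B := ⨅ k, (bounds d l k).2
  have hA0 : 0 ≤ A := ge_of_tendsto' hA fun k => (bounds_fst_nonneg hl k).1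
  have hAB : A ≤ B := le_of_tendsto_of_tendsto' hA hB fun k => (bounds_fst_nonneg hl k).2.1
  have hc : ∀ y, 0 ≤ y → ContinuousAt (treeMap d l) y := by
    intro y hy
    unfold treeMap
    exact ContinuousAt.div (by fun_prop) (by fun_prop) (by positivity)
  -- Each round swaps the two bounds, so their limits form a cycle A ↔ B, which must be degenerate.
  have h1 : treeMap d l B = A :=
    tendsto_nhds_unique ((hc B (hA0.trans hAB)).tendsto.comp hB) ((tendsto_add_atTop_iff_nat 1).2 hA)
  have h2 : treeMap d l A = B :=
    tendsto_nhds_unique ((hc A hA0).tendsto.comp hA) ((tendsto_add_atTop_iff_nat 1).2 hB)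
  have hApos : 0 < A := h1 ▸ treeMap_pos hl (hA0.trans hAB)
  rcases hAB.lt_or_eq with h | h
  · exact (not_two_cycle_of_lt hd hl hlc hApos h h1 h2).elim
  · exact ⟨A, hA, h ▸ hB⟩

end TwoCycle

/-! ### Parametrising the activity by the fixed point -/

section Activity

/-- The activity `l` for which `x = 1 / (1 + l * x ^ d)`. -/
noncomputable def activity (d : ℕ) (x : ℝ) : ℝ := (1 - x) / x ^ (d + 1)

variable {d : ℕ}

theorem activity_nonneg {x : ℝ} (hx : 0 < x) (hx1 : x ≤ 1) : 0 ≤ activity d x :=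
  div_nonneg (by linarith) (by positivity)

theorem activity_anti {x y : ℝ} (hx : 0 < x) (hxy : x ≤ y) (hy : y ≤ 1) :
    activity d y ≤ activity d x := by
  unfold activity
  have : 0 ≤ 1 - x := by linarith
  gcongr

theorem treeMap_activity {x : ℝ} (hx : 0 < x) : treeMap d (activity d x) x = x := by
  have h : 1 + activity d x * x ^ d = 1 / x := by
    unfold activity
    rw [pow_succ]
    field_simp
    ring
  rw [treeMap, h, one_div_one_div]

theorem hasDerivAt_activity {x : ℝ} (hx : 0 < x) :
    HasDerivAt (activity d) (-(((d : ℝ) + 1) - d * x) / x ^ (d + 2)) x := by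
  have h := ((hasDerivAt_id x).const_sub 1).div (hasDerivAt_pow (d + 1) x) (by positivity)
  refine h.congr_deriv ?_
  simp only [id, Nat.add_sub_cancel]
  push_cast
  field_simp
  ring

/-- `log (growthRate (d + 1) x)`, written out. -/
noncomputable def logGrowth (d : ℕ) (x : ℝ) : ℝ :=
  -(((d : ℝ) + 1) / 2) * Real.log x - ((d : ℝ) - 1) / 2 * Real.log (2 - x)

theorem log_growthRate {x : ℝ} (hx : 0 < x) (hx2 : x < 2) :
    Real.log (growthRate (d + 1) x) = logGrowth d x := by
  have h2 : 0 < 2 - x := by linarith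
  rw [growthRate, Real.log_mul (Real.rpow_pos_of_pos hx _).ne' (Real.rpow_pos_of_pos h2 _).ne',
    Real.log_rpow hx, Real.log_rpow h2, logGrowth]
  push_cast
  ring

/-- The derivative is written as that of `activity` times x^(d+1)/(2 - x), ready to be compared with
the chain rule for log Z. -/
theorem hasDerivAt_logGrowth {x : ℝ} (hx : 0 < x) (hx2 : x < 2) :
    HasDerivAt (logGrowth d)
      (-(((d : ℝ) + 1) - d * x) / x ^ (d + 2) * (x ^ (d + 1) / (2 - x))) x := by
  have h2 : 0 < 2 - x := by linarith
  have h := ((Real.hasDerivAt_log hx.ne').const_mul (-(((d : ℝ) + 1) / 2))).sub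
    ((((hasDerivAt_id x).const_sub 2).log h2.ne').const_mul (((d : ℝ) - 1) / 2))
  refine h.congr_deriv ?_
  simp only [id]
  field_simp
  ring

theorem logGrowth_one : logGrowth d 1 = 0 := by
  norm_num [logGrowth]

/-- The gap between the two bounds on the product of `d + 1` cavity ratios after `k` steps. -/
noncomputable def gap (d k : ℕ) (x : ℝ) : ℝ :=
  (bounds d (activity d x) k).2 ^ (d + 1) - (bounds d (activity d x) k).1 ^ (d + 1)

theorem continuousOn_bounds {x₀ : ℝ} (hx₀ : 0 < x₀) (k : ℕ) :
    ContinuousOn (fun x => (bounds d (activity d x) k).1) (Set.Icc x₀ 1) ∧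
      ContinuousOn (fun x => (bounds d (activity d x) k).2) (Set.Icc x₀ 1) := by
  have hact : ContinuousOn (activity d) (Set.Icc x₀ 1) := fun x hx =>
    (hasDerivAt_activity (hx₀.trans_le hx.1)).continuousAt.continuousWithinAt
  induction k with
  | zero => exact ⟨continuousOn_const, continuousOn_const⟩
  | succ k ih =>
    have hne : ∀ x ∈ Set.Icc x₀ 1, ∀ y : ℝ, 0 ≤ y → 1 + activity d x * y ^ d ≠ 0 := by
      intro x hx y hy
      have := activity_nonneg (d := d) (hx₀.trans_le hx.1) hx.2
      positivity
    refine ⟨continuousOn_const.div (continuousOn_const.add (hact.mul (ih.2.pow d))) ?_,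
      continuousOn_const.div (continuousOn_const.add (hact.mul (ih.1.pow d))) ?_⟩
    · intro x hx
      exact hne x hx _ (bounds_snd_nonneg (activity_nonneg (hx₀.trans_le hx.1) hx.2) k)
    · intro x hx
      exact hne x hx _ (bounds_fst_nonneg (activity_nonneg (hx₀.trans_le hx.1) hx.2) k).1

/-- Dini's theorem: the gaps are continuous, decrease in k and tend to 0 pointwise. As `activity`
decreases in x, subcriticality at x₀ covers the whole interval. -/
theorem tendstoUniformlyOn_gap (hd : 1 ≤ d) {x₀ : ℝ} (hx₀ : 0 < x₀)
    (hlc : 1 < d → activity d x₀ < (d : ℝ) ^ d / ((d : ℝ) - 1) ^ (d + 1)) :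
    TendstoUniformlyOn (gap d) (fun _ => 0) atTop (Set.Icc x₀ 1) := by
  refine Antitone.tendstoUniformlyOn_of_forall_tendsto isCompact_Icc ?_ ?_ continuousOn_const ?_
  · intro k
    exact ((continuousOn_bounds hx₀ k).2.pow _).sub ((continuousOn_bounds hx₀ k).1.pow _)
  · intro x hx
    have hl := activity_nonneg (d := d) (hx₀.trans_le hx.1) hx.2
    refine antitone_nat_of_succ_le fun k => ?_
    have h := bounds_step (d := d) hl k
    exact sub_le_sub (pow_le_pow_left₀ (bounds_snd_nonneg hl _) h.2 _)
      (pow_le_pow_left₀ (bounds_fst_nonneg hl _).1 h.1 _)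
  · intro x hx
    have hl := activity_nonneg (d := d) (hx₀.trans_le hx.1) hx.2
    obtain ⟨z, h1, h2⟩ := tendsto_bounds hd hl fun h =>
      (activity_anti hx₀ hx.1 hx.2).trans_lt (hlc h)
    have := (h2.pow (d + 1)).sub (h1.pow (d + 1))
    rwa [sub_self] at this

theorem div_one_add_mul_sub_le {l y z : ℝ} (hl : 0 ≤ l) (hy : 0 ≤ y) (hyz : y ≤ z) :
    y / (1 + l * y) ≤ z / (1 + l * z) ∧ z / (1 + l * z) - y / (1 + l * y) ≤ z - y := by
  have hz : 0 ≤ z := hy.trans hyz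
  have h1 : 0 < 1 + l * y := by positivity
  have h2 : 0 < 1 + l * z := by positivity
  have e : z / (1 + l * z) - y / (1 + l * y) = (z - y) / ((1 + l * z) * (1 + l * y)) := by
    field_simp
    ring
  have h3 : 0 ≤ z - y := by linarith
  refine ⟨sub_nonneg.1 (e ▸ by positivity), ?_⟩
  rw [e]
  refine div_le_self h3 ?_
  have := mul_nonneg hl hy
  have := mul_nonneg hl hz
  nlinarith

/-- The map y ↦ y/(1 + l y) is increasing and 1-Lipschitz on y ≥ 0, and at y = x^(d+1) its
denominator is 2 - x. -/
theorem abs_sub_le_gap {x : ℝ} (hx : 0 < x) (hx1 : x ≤ 1) (k : ℕ) {q : ℝ}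
    (h1 : (bounds d (activity d x) k).1 ^ (d + 1) /
      (1 + activity d x * (bounds d (activity d x) k).1 ^ (d + 1)) ≤ q)
    (h2 : q ≤ (bounds d (activity d x) k).2 ^ (d + 1) /
      (1 + activity d x * (bounds d (activity d x) k).2 ^ (d + 1))) :
    |q - x ^ (d + 1) / (2 - x)| ≤ gap d k x := by
  have hl := activity_nonneg (d := d) hx hx1
  have hm := bounds_mem_of_fixed hl hx.le (treeMap_activity hx) k
  have ha := (bounds_fst_nonneg (d := d) hl k).1
  have e : x ^ (d + 1) / (2 - x) = x ^ (d + 1) / (1 + activity d x * x ^ (d + 1)) := by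
    congr 1
    unfold activity
    field_simp
    ring
  have p1 := pow_le_pow_left₀ ha hm.1 (d + 1)
  have p2 := pow_le_pow_left₀ hx.le hm.2 (d + 1)
  have q1 := div_one_add_mul_sub_le hl (pow_nonneg ha (d + 1)) p1
  have q2 := div_one_add_mul_sub_le hl (pow_nonneg hx.le (d + 1)) p2
  rw [e, gap, abs_le]
  constructor <;> linarith [q1.1, q1.2, q2.1, q2.2]

end Activity

/-! ### Integration along the curve, and numerical values -/

section Main

variable {d : ℕ}

theorem abs_log_partitionFunction_sub_le {V : Type*} [Fintype V] [Nonempty V] [DecidableEq V]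
    {G : SimpleGraph V} [G.LocallyFinite] (hG : G.IsRegularOfDegree (d + 1)) (k : ℕ)
    (hg : ((k + 3 : ℕ) : ℕ∞) ≤ G.egirth) {x₀ ε : ℝ} (hx₀ : 0 < x₀) (hx₁ : x₀ ≤ 1)
    (hε : ∀ x ∈ Set.Icc x₀ 1, gap d k x ≤ ε) :
    |Real.log (partitionFunction (activity d x₀) G) / Fintype.card V - logGrowth d x₀| ≤
      ((d : ℝ) + 1) / x₀ ^ (d + 2) * ε := by
  have hn : (0 : ℝ) < Fintype.card V := by exact_mod_cast Fintype.card_pos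
  set Q : ℝ → ℝ := fun x => (∑ v, inducedSum G (activity d x)
    (Finset.univ.erase v \ G.neighborFinset v)) / partitionFunction (activity d x) G /
      Fintype.card V with hQ
  have hderiv : ∀ x ∈ Set.Icc x₀ 1, HasDerivWithinAt
      (fun x => Real.log (partitionFunction (activity d x) G) / Fintype.card V - logGrowth d x)
      (-(((d : ℝ) + 1) - d * x) / x ^ (d + 2) * (Q x - x ^ (d + 1) / (2 - x)))
      (Set.Icc x₀ 1) x := by
    intro x hx
    have hx0 := hx₀.trans_le hx.1
    have hl := activity_nonneg (d := d) hx0 hx.2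
    have hpos : 0 < partitionFunction (activity d x) G := by
      rw [partitionFunction_eq_inducedSum]
      exact inducedSum_pos hl _
    have h1 := (hasDerivAt_partitionFunction (G := G) (activity d x)).comp x
      (hasDerivAt_activity hx0)
    have h2 := ((h1.log hpos.ne').div_const (Fintype.card V : ℝ)).sub
      (hasDerivAt_logGrowth (d := d) hx0 (hx.2.trans_lt one_lt_two))
    refine (h2.congr_deriv ?_).hasDerivWithinAt
    simp only [hQ, Function.comp]
    ring
  have hbound : ∀ x ∈ Set.Icc x₀ 1,
      ‖-(((d : ℝ) + 1) - d * x) / x ^ (d + 2) * (Q x - x ^ (d + 1) / (2 - x))‖ ≤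
        ((d : ℝ) + 1) / x₀ ^ (d + 2) * ε := by
    intro x hx
    have hx0 := hx₀.trans_le hx.1
    have hl := activity_nonneg (d := d) hx0 hx.2
    have hpos : 0 < partitionFunction (activity d x) G := by
      rw [partitionFunction_eq_inducedSum]
      exact inducedSum_pos hl _
    have hQx : |Q x - x ^ (d + 1) / (2 - x)| ≤ ε := by
      refine (abs_sub_le_gap hx0 hx.2 k ?_ ?_).trans (hε x hx)
      · rw [hQ, le_div_iff₀ hn, le_div_iff₀ hpos, mul_comm _ (Fintype.card V : ℝ), mul_assoc,
          ← nsmul_eq_mul]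
        exact Finset.card_nsmul_le_sum _ _ _ fun v _ => (bounds_root hl hG k hg v).1
      · rw [hQ, div_le_iff₀ hn, div_le_iff₀ hpos, mul_comm _ (Fintype.card V : ℝ), mul_assoc,
          ← nsmul_eq_mul]
        exact Finset.sum_le_card_nsmul _ _ _ fun v _ => (bounds_root hl hG k hg v).2
    rw [norm_mul, Real.norm_eq_abs, Real.norm_eq_abs, abs_div, abs_neg,
      abs_of_pos (pow_pos hx0 _)]
    have hdx : (d : ℝ) * x ≤ d := mul_le_of_le_one_right (Nat.cast_nonneg d) hx.2
    have hdx0 : 0 ≤ (d : ℝ) * x := by positivity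
    rw [abs_of_nonneg (by linarith)]
    refine mul_le_mul ?_ hQx (abs_nonneg _) (by positivity)
    exact div_le_div₀ (by positivity) (by linarith) (by positivity)
      (pow_le_pow_left₀ hx₀.le hx.1 _)
  -- Mean value inequality between x = 1, where both logarithms vanish, and x₀; the interval has
  -- length at most 1.
  have hmv := (convex_Icc x₀ 1).norm_image_sub_le_of_norm_hasDerivWithin_le hderiv hbound
    (Set.right_mem_Icc.2 hx₁) (Set.left_mem_Icc.2 hx₁)
  have hact : activity d 1 = 0 := by simp [activity]
  simp only [hact, partitionFunction_zero, logGrowth_one, Real.log_one, zero_div, sub_zero]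
    at hmv
  refine hmv.trans ?_
  have hC : 0 ≤ ((d : ℝ) + 1) / x₀ ^ (d + 2) * ε :=
    (norm_nonneg _).trans (hbound x₀ (Set.left_mem_Icc.2 hx₁))
  refine mul_le_of_le_one_right hC ?_
  rw [Real.norm_eq_abs, abs_le]
  constructor <;> linarith

theorem tendsto_supDeviation (hd : 1 ≤ d) {x : ℝ} (hx : 0 < x) (hx1 : x ≤ 1)
    (hlc : 1 < d → activity d x < (d : ℝ) ^ d / ((d : ℝ) - 1) ^ (d + 1)) :
    Tendsto (fun g : ℕ => supDeviation (d + 1) g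
      (fun G => partitionFunction (activity d x) G) (Real.log (growthRate (d + 1) x)))
      atTop (𝓝 0) := by
  classical
  have hu := Metric.tendstoUniformlyOn_iff.1 (tendstoUniformlyOn_gap hd hx hlc)
  rw [ENNReal.tendsto_nhds_zero]
  intro e he
  rcases eq_or_ne e ⊤ with rfl | hetop
  · simp
  have he' : 0 < e.toReal := ENNReal.toReal_pos he.ne' hetop
  set C := ((d : ℝ) + 1) / x ^ (d + 2) with hC
  have hCpos : 0 < C := by positivity
  obtain ⟨k, hk⟩ := (hu (e.toReal / C) (by positivity)).exists
  filter_upwards [eventually_ge_atTop (k + 3)] with g hg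
  unfold supDeviation
  refine iSup_le fun n => iSup_le fun hn => iSup_le fun G => iSup_le fun hG => ?_
  refine ENNReal.ofReal_le_of_le_toReal ?_
  have : Nonempty (Fin n) := ⟨⟨0, hn⟩⟩
  have h := abs_log_partitionFunction_sub_le (G := G) hG.1 k
    (le_trans (by exact_mod_cast hg) hG.2) hx hx1 (ε := e.toReal / C) fun y hy => by
      have := hk y hy
      rw [dist_comm, Real.dist_eq, sub_zero] at this
      exact (le_abs_self _).trans this.le
  rw [log_growthRate hx (hx1.trans_lt one_lt_two)]
  rw [Fintype.card_fin, ← hC, mul_div_cancel₀ _ hCpos.ne'] at h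
  exact h

theorem isPositiveSolution_iff {l x : ℝ} (hl : 0 ≤ l) :
    IsPositiveSolution (d + 1) l x ↔ 0 < x ∧ x + l * x ^ (d + 1) = 1 := by
  unfold IsPositiveSolution
  rw [Nat.add_sub_cancel]
  refine and_congr_right fun hx => ?_
  rw [eq_div_iff (by positivity), mul_add, mul_one, pow_succ]
  constructor <;> intro h <;> linarith

theorem strictMonoOn_add_mul_pow {l : ℝ} (hl : 0 ≤ l) :
    StrictMonoOn (fun x : ℝ => x + l * x ^ (d + 1)) (Set.Ici 0) := by
  intro x hx y _ hxy
  exact add_lt_add_of_lt_of_le hxy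
    (mul_le_mul_of_nonneg_left (pow_le_pow_left₀ hx hxy.le _) hl)

theorem exists_mem_Ioo_isPositiveSolution {l a b : ℝ} (hl : 0 ≤ l) (ha : 0 ≤ a) (hab : a ≤ b)
    (h1 : a + l * a ^ (d + 1) < 1) (h2 : 1 < b + l * b ^ (d + 1)) :
    ∃ x ∈ Set.Ioo a b, IsPositiveSolution (d + 1) l x := by
  obtain ⟨x, hx, hx'⟩ := intermediate_value_Ioo (f := fun x : ℝ => x + l * x ^ (d + 1)) hab
    (by fun_prop) ⟨h1, h2⟩
  exact ⟨x, hx, (isPositiveSolution_iff hl).2 ⟨ha.trans_lt hx.1, hx'⟩⟩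

theorem existsUnique_isPositiveSolution {l : ℝ} (hl : 0 < l) :
    ∃! x : ℝ, IsPositiveSolution (d + 1) l x := by
  obtain ⟨x, -, hx⟩ := exists_mem_Ioo_isPositiveSolution (d := d) hl.le le_rfl zero_le_one
    (by simp) (by simpa using hl)
  refine ⟨x, hx, fun y hy => ?_⟩
  rw [isPositiveSolution_iff hl.le] at hx hy
  exact (strictMonoOn_add_mul_pow hl.le).injOn (Set.mem_Ici.2 hy.1.le) (Set.mem_Ici.2 hx.1.le)
    (hy.2.trans hx.2.symm)

theorem IsPositiveSolution.le_one {l x : ℝ} (hl : 0 ≤ l) (h : IsPositiveSolution (d + 1) l x) :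
    x ≤ 1 := by
  rw [isPositiveSolution_iff hl] at h
  have := mul_nonneg hl (pow_nonneg h.1.le (d + 1))
  linarith

theorem IsPositiveSolution.activity_eq {l x : ℝ} (hl : 0 ≤ l)
    (h : IsPositiveSolution (d + 1) l x) : activity d x = l := by
  rw [isPositiveSolution_iff hl] at h
  rw [activity, div_eq_iff (pow_pos h.1 _).ne']
  linarith

theorem IsPositiveSolution.tendsto_supDeviation {r : ℕ} {l x : ℝ} (hr : 2 ≤ r) (hl : 0 < l)
    (hlc : 2 < r → l < ((r : ℝ) - 1) ^ (r - 1) / ((r : ℝ) - 2) ^ r)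
    (h : IsPositiveSolution r l x) :
    Tendsto (fun g : ℕ => supDeviation r g (fun G => partitionFunction l G)
      (Real.log (growthRate r x))) atTop (𝓝 0) := by
  obtain ⟨d, rfl⟩ : ∃ d, r = d + 1 := ⟨r - 1, by omega⟩
  have e := h.activity_eq hl.le
  have := HardCore.tendsto_supDeviation (d := d) (by omega) h.1 (h.le_one hl.le) fun hd => by
    rw [e]
    have := hlc (by omega)
    push_cast at this
    rwa [add_sub_cancel_right, show (d : ℝ) + 1 - 2 = d - 1 by ring] at this
  rwa [e] at this

/-- Squaring removes the half-integer exponents, and x^(d+2) = 1 - x at activity 1. The remaining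
factor is decreasing in x, so rational brackets for x give brackets for the growth rate. -/
theorem IsPositiveSolution.growthRate_sq {x : ℝ} (h : IsPositiveSolution (d + 2) 1 x) :
    growthRate (d + 2) x ^ 2 * ((1 - x) * (2 - x) ^ d) = 1 := by
  have hx1 := h.le_one zero_le_one
  have h2 : 0 < 2 - x := by linarith
  have hx := h.1
  rw [isPositiveSolution_iff zero_le_one, one_mul] at h
  have e : 1 - x = x ^ (d + 2) := by linarith [h.2]
  rw [growthRate, e, mul_pow, ← Real.rpow_natCast, ← Real.rpow_natCast, ← Real.rpow_mul hx.le,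
    ← Real.rpow_mul h2.le, ← Real.rpow_natCast x, ← Real.rpow_natCast (2 - x) d]
  have e1 : -(((d + 2 : ℕ) : ℝ) / 2) * (2 : ℕ) = -((d + 2 : ℕ) : ℝ) := by push_cast; ring
  have e2 : -((((d + 2 : ℕ) : ℝ) - 2) / 2) * (2 : ℕ) = -(d : ℝ) := by push_cast; ring
  rw [e1, e2, mul_mul_mul_comm, ← Real.rpow_add hx, ← Real.rpow_add h2]
  simp

theorem exists_isPositiveSolution_one {a b y z : ℝ} (hy : 0 ≤ y) (hyz : y ≤ z) (hz : z ≤ 1)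
    (h1 : y + y ^ (d + 2) < 1) (h2 : 1 < z + z ^ (d + 2)) (_ : 0 ≤ a) (_ : 0 ≤ b)
    (hay : a ^ 2 * ((1 - y) * (2 - y) ^ d) < 1) (hbz : 1 < b ^ 2 * ((1 - z) * (2 - z) ^ d)) :
    ∃ x, IsPositiveSolution (d + 2) 1 x ∧ a < growthRate (d + 2) x ∧
      growthRate (d + 2) x < b := by
  obtain ⟨x, hx, h⟩ := exists_mem_Ioo_isPositiveSolution (d := d + 1) zero_le_one hy hyz
    (by simpa using h1) (by simpa using h2)
  refine ⟨x, h, ?_, ?_⟩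
  all_goals
    have hg : 0 ≤ growthRate (d + 2) x :=
      mul_nonneg (Real.rpow_nonneg h.1.le _) (Real.rpow_nonneg (by linarith [hx.2]) _)
    have hs := h.growthRate_sq
    by_contra! hc
    have hc2 := pow_le_pow_left₀ (by assumption) hc 2
    have hx2 : 0 ≤ 2 - x := by linarith [hx.2]
    have hx1 : 0 ≤ 1 - x := by linarith [hx.2]
  · have h3 : (2 - x) ^ d ≤ (2 - y) ^ d := pow_le_pow_left₀ hx2 (by linarith [hx.1]) d
    have h4 : (1 - x) * (2 - x) ^ d ≤ (1 - y) * (2 - y) ^ d :=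
      mul_le_mul (by linarith [hx.1]) h3 (pow_nonneg hx2 d) (by linarith [hx.1])
    have h5 := mul_le_mul hc2 h4 (mul_nonneg hx1 (pow_nonneg hx2 d)) (sq_nonneg a)
    linarith
  · have h3 : (2 - z) ^ d ≤ (2 - x) ^ d := pow_le_pow_left₀ (by linarith) (by linarith [hx.2]) d
    have h4 : (1 - z) * (2 - z) ^ d ≤ (1 - x) * (2 - x) ^ d :=
      mul_le_mul (by linarith [hx.2]) h3 (pow_nonneg (by linarith) d) hx1
    have h5 := mul_le_mul hc2 h4 (mul_nonneg (by linarith) (pow_nonneg (by linarith) d))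
      (sq_nonneg _)
    linarith

end Main

end HardCore

/-- For `r = 2` the bound `(r - 1) ^ (r - 1) / (r - 2) ^ r` is infinite, so that there is no upper
restriction on the activity `l` in that case. -/
theorem theorem3 :
    (∀ (r : ℕ) (l : ℝ), 2 ≤ r → 0 < l →
      (2 < r → l < ((r : ℝ) - 1) ^ (r - 1) / ((r : ℝ) - 2) ^ r) →
        (∃! x : ℝ, HardCore.IsPositiveSolution r l x) ∧
        ∀ x : ℝ, HardCore.IsPositiveSolution r l x →
          Tendsto
            (fun g : ℕ => HardCore.supDeviation r g (fun G => HardCore.partitionFunction l G)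
              (Real.log (HardCore.growthRate r x)))
            atTop (𝓝 0)) ∧
    (∀ (r : ℕ) (a b : ℝ),
      (r, a, b) ∈ ({(2, 1.618, 1.619), (3, 1.545, 1.546), (4, 1.4936, 1.4937),
        (5, 1.453, 1.454)} : Set (ℕ × ℝ × ℝ)) →
        ∃ x : ℝ, HardCore.IsPositiveSolution r 1 x ∧
          a < HardCore.growthRate r x ∧ HardCore.growthRate r x < b ∧
          Tendsto
            (fun g : ℕ => HardCore.supDeviation r g
              (fun G => ((HardCore.indepSets G).card : ℝ))
              (Real.log (HardCore.growthRate r x)))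
            atTop (𝓝 0)) := by
  refine ⟨fun r l hr hl hlc => ⟨?_, fun x hx => hx.tendsto_supDeviation hr hl hlc⟩, ?_⟩
  · obtain ⟨d, rfl⟩ : ∃ d, r = d + 1 := ⟨r - 1, by omega⟩
    exact HardCore.existsUnique_isPositiveSolution hl
  · intro r a b h
    have key : 2 ≤ r ∧ (2 < r → (1 : ℝ) < ((r : ℝ) - 1) ^ (r - 1) / ((r : ℝ) - 2) ^ r) ∧
        ∃ x, HardCore.IsPositiveSolution r 1 x ∧ a < HardCore.growthRate r x ∧
          HardCore.growthRate r x < b := by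
      simp only [Set.mem_insert_iff, Set.mem_singleton_iff, Prod.mk.injEq] at h
      rcases h with ⟨rfl, rfl, rfl⟩ | ⟨rfl, rfl, rfl⟩ | ⟨rfl, rfl, rfl⟩ | ⟨rfl, rfl, rfl⟩
      -- In each case y and z are decimals bracketing the root of x + x^r = 1 tightly enough to fix
      -- the stated digits.
      · exact ⟨by norm_num, by norm_num, HardCore.exists_isPositiveSolution_one (d := 0)
          (y := 0.61803) (z := 0.6181) (by norm_num) (by norm_num) (by norm_num) (by norm_num)
          (by norm_num) (by norm_num) (by norm_num) (by norm_num) (by norm_num)⟩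
      · exact ⟨by norm_num, by norm_num, HardCore.exists_isPositiveSolution_one (d := 1)
          (y := 0.6823) (z := 0.6824) (by norm_num) (by norm_num) (by norm_num) (by norm_num)
          (by norm_num) (by norm_num) (by norm_num) (by norm_num) (by norm_num)⟩
      · exact ⟨by norm_num, by norm_num, HardCore.exists_isPositiveSolution_one (d := 2)
          (y := 0.72449) (z := 0.7245) (by norm_num) (by norm_num) (by norm_num) (by norm_num)
          (by norm_num) (by norm_num) (by norm_num) (by norm_num) (by norm_num)⟩
      · exact ⟨by norm_num, by norm_num, HardCore.exists_isPositiveSolution_one (d := 3)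
          (y := 0.75487) (z := 0.75488) (by norm_num) (by norm_num) (by norm_num) (by norm_num)
          (by norm_num) (by norm_num) (by norm_num) (by norm_num) (by norm_num)⟩
    obtain ⟨hr, hlc, x, hx, hax, hxb⟩ := key
    refine ⟨x, hx, hax, hxb, ?_⟩
    simpa only [HardCore.partitionFunction_one] using hx.tendsto_supDeviation hr one_pos hlc
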